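/- Let $n\ge 0$ be an integer and let $\mathcal{K}^n$ be the set of convex bodies in $\mathbb{R}^n$ (compact convex sets with nonempty interior), endowed with the Hausdorff metric $d_H$ of the Euclidean norm $|\cdot|$. For $K\in\mathcal{K}^n$ and $z\in\operatorname{int}(K)$, let $$K^z=\{y\in\mathbb{R}^n : \langle y,x-z\rangle\le 1 \text{ for all } x\in K\}$$ be the polar body of $K$ with center of polarity $z$, and write $\operatorname{vol}$ for Lebesgue measure on $\mathbb{R}^n$. Then every $K\in\mathcal{K}^n$ has a unique Santaló point, that is, there is a unique point $s(K)\in\operatorname{int}(K)$ such that $$\operatorname{vol}\big(K^{s(K)}\big)=\min_{z\in\operatorname{int}(K)}\operatorname{vol}(K^z),$$ and the Santaló map $s:(\mathcal{K}^n,d_H)\to\mathbb{R}^n$ so defined is continuous. Furthermore, for every $K_0\in\mathcal{K}^n$ there exist constants $C=C(K_0)>0$ and $\delta=\delta(K_0)>0$ such that, for every $K\in\mathcal{K}^n$, $$d_H(K,K_0)\le\delta \quad\Rightarrow\quad |s(K)-s(K_0)|\le C\,d_H(K,K_0).$$ -/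

import Mathlib

/-- The space `𝒦ⁿ` of convex bodies in `ℝⁿ`: compact convex sets with nonempty interior. (Mathlib's
`ConvexBody` only asks for a nonempty set.) As a subtype of `ConvexBody` it carries the Hausdorff
metric of the Euclidean distance: `dist K L = Metric.hausdorffDist K L`. -/
abbrev FullConvexBody (n : ℕ) : Type :=
  {K : ConvexBody (EuclideanSpace ℝ (Fin n)) // (interior (K : Set (EuclideanSpace ℝ (Fin n)))).Nonempty}

/-- The polar body `K^z = {y : ⟨y, x - z⟩ ≤ 1 for all x ∈ K}` of `K` with center of polarity `z`. -/
def polarBody {n : ℕ} (K : Set (EuclideanSpace ℝ (Fin n))) (z : EuclideanSpace ℝ (Fin n)) :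
    Set (EuclideanSpace ℝ (Fin n)) :=
  {y | ∀ x ∈ K, inner ℝ y (x - z) ≤ 1}

/-- `z` is a Santaló point of `K`: an interior point of `K` at which the Lebesgue measure of the
polar body `K^z` attains its minimum over the interior of `K`. -/
def IsSantaloPoint {n : ℕ} (K : Set (EuclideanSpace ℝ (Fin n))) (z : EuclideanSpace ℝ (Fin n)) :
    Prop :=
  z ∈ interior K ∧
    ∀ w ∈ interior K, MeasureTheory.volume (polarBody K z) ≤ MeasureTheory.volume (polarBody K w)

/-- The Santaló map `s`, sending a convex body to its Santaló point. -/
noncomputable def santaloMap {n : ℕ} (K : FullConvexBody n) : EuclideanSpace ℝ (Fin n) :=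
  Classical.epsilon fun z => IsSantaloPoint (K.1 : Set (EuclideanSpace ℝ (Fin n))) z

/-!
For `z` in the convex body `K` the gauge of the polar body `K^z` is `y ↦ h_K(y) - ⟪y, z⟫`, where `h_K`
is the support function. Integrating `exp (-gauge)` in layers
(`lintegral_exp_neg_eq_factorial_mul_measure`) gives
`n! * vol (K^z) = ∫ exp (⟪y, z⟫ - h_K(y)) dy =: Φ_K(z)`, a Laplace transform in `z`.

* Existence: `Φ_K` is lower semicontinuous by Fatou's lemma, so it attains its minimum on the compact
  set `K`; it is finite in the interior and infinite on the boundary (`measure_sublevel_eq_top`),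
  because there `K^z` contains infinitely many disjoint congruent balls. So the minimum is attained in
  the interior (`exists_min_measure_sublevel`), and the gradient of `Φ_K` vanishes at every minimizer.
* Stability: the gradient of `Φ_K` is strongly monotone on the interior of `K`, with a constant that
  depends only on the radius of a ball about the origin containing `K`
  (`mul_sq_norm_le_integral_sub_integral`): it suffices to integrate over a part of the unit ball.
  On the other hand, at a point deep inside `K₀` and `K` the gradients of `Φ_{K₀}` and `Φ_K` differ by at most a constant times the Hausdorff distance, since
  `|h_K(y) - h_{K₀}(y)| ≤ d_H(K, K₀) * ‖y‖` (`abs_integral_sub_integral_le`). Comparing the gradients of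
  `Φ_K` at `s(K₀)` and `s(K)` yields `‖s(K) - s(K₀)‖ ≤ C * d_H(K, K₀)`
  (`exists_lipschitz_critical_center`).

Uniqueness of the Santaló point is the stability estimate at distance zero, and continuity of `s` is
immediate from the estimate.
-/

open MeasureTheory Set Filter Topology
open scoped RealInnerProductSpace Nat Pointwise

/-! ### The support function -/

section SupportFunction

variable {E : Type*} [NormedAddCommGroup E] [InnerProductSpace ℝ E] {K L : Set E}

/-- The support function `h_K(y) = sup_{x ∈ K} ⟪y, x⟫` of `K`. It is real-valued, so it is meaningful
only for nonempty bounded `K`. -/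
noncomputable def supportFun (K : Set E) (y : E) : ℝ :=
  sSup ((fun x => ⟪y, x⟫) '' K)

theorem inner_le_supportFun (hK : IsCompact K) (y : E) {x : E} (hx : x ∈ K) :
    ⟪y, x⟫ ≤ supportFun K y :=
  le_csSup (hK.image (by fun_prop : Continuous fun x : E => ⟪y, x⟫)).bddAbove (mem_image_of_mem _ hx)

theorem supportFun_le (hne : K.Nonempty) {y : E} {a : ℝ} (h : ∀ x ∈ K, ⟪y, x⟫ ≤ a) :
    supportFun K y ≤ a :=
  csSup_le (hne.image _) (by rintro _ ⟨x, hx, rfl⟩; exact h x hx)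

theorem supportFun_le_mul_norm (hne : K.Nonempty) {R : ℝ} (hR : ∀ x ∈ K, ‖x‖ ≤ R) (y : E) :
    supportFun K y ≤ R * ‖y‖ :=
  supportFun_le hne fun x hx => by
    nlinarith [real_inner_le_norm y x, mul_le_mul_of_nonneg_left (hR x hx) (norm_nonneg y)]

theorem supportFun_add_le (hK : IsCompact K) (hne : K.Nonempty) (y w : E) :
    supportFun K (y + w) ≤ supportFun K y + supportFun K w :=
  supportFun_le hne fun x hx => by
    rw [inner_add_left]
    exact add_le_add (inner_le_supportFun hK y hx) (inner_le_supportFun hK w hx)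

theorem supportFun_smul {t : ℝ} (ht : 0 ≤ t) (y : E) :
    supportFun K (t • y) = t * supportFun K y := by
  have : (fun x => ⟪t • y, x⟫) '' K = t • ((fun x => ⟪y, x⟫) '' K) := by
    rw [← image_smul, image_image]
    simp [real_inner_smul_left]
  rw [supportFun, this, Real.sSup_smul_of_nonneg ht, smul_eq_mul, supportFun]

theorem continuous_supportFun (hK : IsCompact K) (hne : K.Nonempty) :
    Continuous (supportFun K) := by
  obtain ⟨R, hR⟩ := hK.isBounded.exists_norm_le
  have hR0 : 0 ≤ R := (norm_nonneg _).trans (hR _ hne.some_mem)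
  refine (LipschitzWith.of_le_add_mul R.toNNReal fun y w => ?_).continuous
  rw [Real.coe_toNNReal _ hR0, dist_eq_norm]
  calc supportFun K y = supportFun K (w + (y - w)) := by rw [add_sub_cancel]
    _ ≤ supportFun K w + supportFun K (y - w) := supportFun_add_le hK hne _ _
    _ ≤ _ := by gcongr; exact supportFun_le_mul_norm hne hR _

theorem inner_add_mul_norm_le_supportFun (hK : IsCompact K) {z : E} {r : ℝ} (hr : 0 ≤ r)
    (h : Metric.closedBall z r ⊆ K) (y : E) : ⟪y, z⟫ + r * ‖y‖ ≤ supportFun K y := by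
  rcases eq_or_ne y 0 with rfl | hy
  · simpa using inner_le_supportFun hK 0 (h (Metric.mem_closedBall_self hr))
  have hy' : ‖y‖ ≠ 0 := norm_ne_zero_iff.2 hy
  have hmem : z + (r / ‖y‖) • y ∈ K := h <| by
    simp [norm_smul, abs_of_nonneg hr, hy']
  have := inner_le_supportFun hK y hmem
  rw [inner_add_right, real_inner_smul_right, real_inner_self_eq_norm_sq] at this
  convert this using 2
  field_simp

omit [InnerProductSpace ℝ E] in
theorem exists_norm_sub_le_hausdorffDist (hK : IsCompact K) (hL : IsCompact L) (hLne : L.Nonempty)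
    {x : E} (hx : x ∈ K) : ∃ w ∈ L, ‖x - w‖ ≤ Metric.hausdorffDist K L := by
  obtain ⟨w, hw, hxw⟩ := hL.exists_infDist_eq_dist hLne x
  refine ⟨w, hw, ?_⟩
  rw [← dist_eq_norm, ← hxw]
  exact Metric.infDist_le_hausdorffDist_of_mem hx
    (Metric.hausdorffEDist_ne_top_of_nonempty_of_bounded ⟨x, hx⟩ hLne hK.isBounded hL.isBounded)

theorem supportFun_le_add_hausdorffDist (hK : IsCompact K) (hKne : K.Nonempty) (hL : IsCompact L)
    (hLne : L.Nonempty) (y : E) :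
    supportFun K y ≤ supportFun L y + Metric.hausdorffDist K L * ‖y‖ :=
  supportFun_le hKne fun x hx => by
    obtain ⟨w, hw, hd⟩ := exists_norm_sub_le_hausdorffDist hK hL hLne hx
    have h1 : ⟪y, x⟫ = ⟪y, w⟫ + ⟪y, x - w⟫ := by rw [inner_sub_right]; ring
    have h2 := inner_le_supportFun hL y hw
    have h3 := real_inner_le_norm y (x - w)
    have h4 := mul_le_mul_of_nonneg_right hd (norm_nonneg y)
    linarith

end SupportFunction

/-! ### Volumes of sublevel sets and Laplace transforms -/

section Laplace

variable {E : Type*} [NormedAddCommGroup E] [InnerProductSpace ℝ E] [FiniteDimensional ℝ E]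
  [MeasurableSpace E] [BorelSpace E] (μ : Measure E) [μ.IsAddHaarMeasure]

theorem lintegral_Ici_exp_neg {a : ℝ} (ha : 0 ≤ a) :
    ∫⁻ t in Ioi (0 : ℝ), (Ici a).indicator (fun t => ENNReal.ofReal (Real.exp (-t))) t =
      ENNReal.ofReal (Real.exp (-a)) := by
  rw [lintegral_indicator measurableSet_Ici, Measure.restrict_restrict measurableSet_Ici]
  have : (Ici a ∩ Ioi 0 : Set ℝ) =ᵐ[volume] Ioi a := by
    rw [← inter_eq_left.2 (Ioi_subset_Ioi ha)]
    exact ae_eq_set_inter Ioi_ae_eq_Ici.symm (ae_eq_refl _)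
  rw [Measure.restrict_congr_set this, ← integral_exp_neg_Ioi,
    ofReal_integral_eq_lintegral_ofReal (integrableOn_exp_neg_Ioi a)
      (ae_of_all _ fun t => (Real.exp_pos _).le)]

theorem lintegral_pow_mul_exp_neg (n : ℕ) :
    ∫⁻ t in Ioi (0 : ℝ), ENNReal.ofReal (Real.exp (-t)) * ENNReal.ofReal (t ^ n) =
      ENNReal.ofReal n ! := by
  have hn : (0 : ℝ) < n + 1 := by positivity
  have hint := Real.GammaIntegral_convergent hn
  rw [← Real.Gamma_nat_eq_factorial, Real.Gamma_eq_integral hn,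
    ofReal_integral_eq_lintegral_ofReal hint]
  · refine setLIntegral_congr_fun measurableSet_Ioi fun t _ => ?_
    simp only [add_sub_cancel_right, Real.rpow_natCast]
    rw [← ENNReal.ofReal_mul (Real.exp_pos _).le]
  · refine (ae_restrict_iff' measurableSet_Ioi).2 (ae_of_all _ fun t (ht : 0 < t) => ?_)
    show 0 ≤ Real.exp (-t) * t ^ ((n : ℝ) + 1 - 1)
    positivity

/-- The integral of `exp (-g)` determines the volume of the sublevel set `{g ≤ 1}` of a nonnegative
positively homogeneous function `g`; no symmetry of `g` is assumed. -/
theorem lintegral_exp_neg_eq_factorial_mul_measure {g : E → ℝ} (hg : Measurable g)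
    (hg0 : ∀ y, 0 ≤ g y) (hhom : ∀ t : ℝ, 0 < t → ∀ y, g (t • y) = t * g y) :
    ∫⁻ y, ENNReal.ofReal (Real.exp (-g y)) ∂μ =
      ENNReal.ofReal (Module.finrank ℝ E)! * μ {y | g y ≤ 1} := by
  have hmeas : Measurable fun p : E × ℝ =>
      (Ici (g p.1)).indicator (fun t => ENNReal.ofReal (Real.exp (-t))) p.2 := by
    have : (fun p : E × ℝ => (Ici (g p.1)).indicator (fun t => ENNReal.ofReal (Real.exp (-t))) p.2) =
        {p : E × ℝ | g p.1 ≤ p.2}.indicator (fun p => ENNReal.ofReal (Real.exp (-p.2))) := by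
      ext p
      simp [indicator]
    rw [this]
    exact Measurable.indicator (by fun_prop)
      (measurableSet_le (hg.comp measurable_fst) measurable_snd)
  calc ∫⁻ y, ENNReal.ofReal (Real.exp (-g y)) ∂μ
      = ∫⁻ y, (∫⁻ t in Ioi (0 : ℝ),
          (Ici (g y)).indicator (fun t => ENNReal.ofReal (Real.exp (-t))) t) ∂μ := by
        simp_rw [lintegral_Ici_exp_neg (hg0 _)]
    _ = ∫⁻ t in Ioi (0 : ℝ), ∫⁻ y,
          (Ici (g y)).indicator (fun t => ENNReal.ofReal (Real.exp (-t))) t ∂μ :=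
        lintegral_lintegral_swap hmeas.aemeasurable
    _ = ∫⁻ t in Ioi (0 : ℝ),
          ENNReal.ofReal (Real.exp (-t)) * ENNReal.ofReal (t ^ Module.finrank ℝ E) *
            μ {y | g y ≤ 1} := by
        refine setLIntegral_congr_fun measurableSet_Ioi fun t (ht : 0 < t) => ?_
        have h1 : (fun y => (Ici (g y)).indicator (fun t => ENNReal.ofReal (Real.exp (-t))) t) =
            {y | g y ≤ t}.indicator fun _ => ENNReal.ofReal (Real.exp (-t)) := by
          ext y
          simp [indicator]
        have h2 : {y | g y ≤ t} = t • {y | g y ≤ 1} := by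
          ext y
          rw [mem_smul_set_iff_inv_smul_mem₀ ht.ne', mem_ofPred_eq, mem_ofPred_eq,
            hhom _ (inv_pos.2 ht), inv_mul_le_iff₀ ht, mul_one]
        rw [h1, lintegral_indicator_const (measurableSet_le hg measurable_const), h2,
          Measure.addHaar_smul_of_nonneg μ ht.le, mul_assoc]
    _ = _ := by
        rw [lintegral_mul_const _ (by fun_prop), lintegral_pow_mul_exp_neg]

theorem integrable_norm_pow_mul_exp_neg (k : ℕ) {r : ℝ} (hr : 0 < r) :
    Integrable (fun y : E => ‖y‖ ^ k * Real.exp (-(r * ‖y‖))) μ := by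
  set n := Module.finrank ℝ E
  obtain ⟨C, hC⟩ : ∃ C : ℝ, ∀ t : ℝ, 0 ≤ t → t ^ k * Real.exp (-(r * t)) * (1 + t) ^ (n + 1) ≤ C := by
    refine ⟨(k + (n + 1))! / r ^ (k + (n + 1)) * Real.exp r, fun t ht => ?_⟩
    have h1 := Real.pow_div_factorial_le_exp (r * (1 + t)) (by positivity) (k + (n + 1))
    rw [div_le_iff₀ (by positivity), mul_pow] at h1
    have h2 : t ^ k * (1 + t) ^ (n + 1) ≤ (1 + t) ^ (k + (n + 1)) := by
      rw [pow_add (1 + t) k]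
      gcongr
      linarith
    calc t ^ k * Real.exp (-(r * t)) * (1 + t) ^ (n + 1)
        = t ^ k * (1 + t) ^ (n + 1) * Real.exp (-(r * t)) := by ring
      _ ≤ (1 + t) ^ (k + (n + 1)) * Real.exp (-(r * t)) := by gcongr
      _ ≤ (Real.exp (r * (1 + t)) * (k + (n + 1))! / r ^ (k + (n + 1))) * Real.exp (-(r * t)) := by
          gcongr
          rw [le_div_iff₀ (by positivity)]
          linarith
      _ = _ := by
          rw [mul_add, mul_one, Real.exp_add, Real.exp_neg]
          field_simp
  have hint : Integrable (fun y : E => C * (1 + ‖y‖) ^ (-((n + 1 : ℕ) : ℝ))) μ :=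
    (integrable_one_add_norm (by push_cast; linarith)).const_mul C
  refine hint.mono' (by fun_prop) (ae_of_all _ fun y => ?_)
  rw [Real.norm_of_nonneg (by positivity), Real.rpow_neg (by positivity), Real.rpow_natCast,
    ← div_eq_mul_inv, le_div_iff₀ (by positivity)]
  exact hC _ (norm_nonneg y)

end Laplace

/-! ### The Laplace transform of a convex body -/

section PolarDensity

variable {E : Type*} [NormedAddCommGroup E] [InnerProductSpace ℝ E] {K L : Set E} {z : E}

/-- The function `y ↦ exp (⟪y, z⟫ - h_K(y))`, whose integral is `n!` times the volume of the polar
body of `K` with center `z`. As a function of `z` it is log-affine. -/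
noncomputable def polarDensity (K : Set E) (z y : E) : ℝ :=
  Real.exp (⟪y, z⟫ - supportFun K y)

theorem polarDensity_pos (K : Set E) (z y : E) : 0 < polarDensity K z y := Real.exp_pos _

theorem continuous_polarDensity (hK : IsCompact K) (hne : K.Nonempty) (z : E) :
    Continuous (polarDensity K z) := by
  have := continuous_supportFun hK hne
  unfold polarDensity
  fun_prop

theorem polarDensity_le {r : ℝ} (hr : ∀ y, ⟪y, z⟫ + r * ‖y‖ ≤ supportFun K y) (y : E) :
    polarDensity K z y ≤ Real.exp (-(r * ‖y‖)) :=
  Real.exp_le_exp.2 (by linarith [hr y])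

theorem exists_inner_add_mul_norm_le_supportFun (hK : IsCompact K) (hz : z ∈ interior K) :
    ∃ r > 0, ∀ y, ⟪y, z⟫ + r * ‖y‖ ≤ supportFun K y := by
  obtain ⟨r, hr, h⟩ := Metric.nhds_basis_closedBall.mem_iff.1 (mem_interior_iff_mem_nhds.1 hz)
  exact ⟨r, hr, inner_add_mul_norm_le_supportFun hK hr.le h⟩

variable [FiniteDimensional ℝ E] [MeasurableSpace E] [BorelSpace E]
  (μ : Measure E) [μ.IsAddHaarMeasure]

theorem lintegral_polarDensity (hK : IsCompact K) (hz : z ∈ K) :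
    ∫⁻ y, ENNReal.ofReal (polarDensity K z y) ∂μ =
      ENNReal.ofReal (Module.finrank ℝ E)! * μ {y | supportFun K y - ⟪y, z⟫ ≤ 1} := by
  have hc := continuous_supportFun hK ⟨z, hz⟩
  rw [← lintegral_exp_neg_eq_factorial_mul_measure μ]
  · simp [polarDensity]
  · fun_prop
  · exact fun y => sub_nonneg.2 (inner_le_supportFun hK y hz)
  · intro t ht y
    rw [supportFun_smul ht.le, real_inner_smul_left, mul_sub]

theorem integrable_polarDensity (hK : IsCompact K) (hne : K.Nonempty) {r : ℝ} (hr : 0 < r)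
    (h : ∀ y, ⟪y, z⟫ + r * ‖y‖ ≤ supportFun K y) : Integrable (polarDensity K z) μ := by
  refine (integrable_norm_pow_mul_exp_neg μ 0 hr).mono'
    (continuous_polarDensity hK hne z).aestronglyMeasurable (ae_of_all _ fun y => ?_)
  rw [Real.norm_of_nonneg (polarDensity_pos K z y).le, pow_zero, one_mul]
  exact polarDensity_le h y

theorem integrable_inner_mul_polarDensity (hK : IsCompact K) (hne : K.Nonempty) {r : ℝ} (hr : 0 < r)
    (h : ∀ y, ⟪y, z⟫ + r * ‖y‖ ≤ supportFun K y) (u : E) :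
    Integrable (fun y => ⟪y, u⟫ * polarDensity K z y) μ := by
  have hc := continuous_polarDensity hK hne z
  refine ((integrable_norm_pow_mul_exp_neg μ 1 hr).const_mul ‖u‖).mono'
    (by fun_prop : Continuous _).aestronglyMeasurable (ae_of_all _ fun y => ?_)
  rw [norm_mul, Real.norm_eq_abs, Real.norm_of_nonneg (polarDensity_pos K z y).le, pow_one, ← mul_assoc,
    mul_comm ‖u‖]
  gcongr
  · exact (polarDensity_pos K z y).le
  · exact abs_real_inner_le_norm y u
  · exact polarDensity_le h y

theorem hasDerivAt_integral_polarDensity (hK : IsCompact K) (hz : z ∈ interior K) (u : E) :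
    HasDerivAt (fun t : ℝ => ∫ y, polarDensity K (z + t • u) y ∂μ)
      (∫ y, ⟪y, u⟫ * polarDensity K z y ∂μ) 0 := by
  have hne : K.Nonempty := ⟨z, interior_subset hz⟩
  obtain ⟨r, hr, h⟩ := exists_inner_add_mul_norm_le_supportFun hK hz
  have hε : 0 < r / 2 / (‖u‖ + 1) := by positivity
  -- on a ball around `0` the centers `z + t • u` stay away from the boundary of `K`
  have hdom : ∀ t ∈ Metric.ball (0 : ℝ) (r / 2 / (‖u‖ + 1)), ∀ y,
      ⟪y, z + t • u⟫ + r / 2 * ‖y‖ ≤ supportFun K y := by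
    intro t ht y
    have ht' : |t| * (‖u‖ + 1) < r / 2 := by
      rwa [mem_ball_zero_iff, Real.norm_eq_abs, lt_div_iff₀ (by positivity)] at ht
    have h1 : t * ⟪y, u⟫ ≤ |t| * (‖y‖ * ‖u‖) := by
      refine (le_abs_self _).trans ?_
      rw [abs_mul]
      gcongr
      exact abs_real_inner_le_norm y u
    rw [inner_add_right, real_inner_smul_right]
    nlinarith [h y, norm_nonneg y, norm_nonneg u, abs_nonneg t]
  have key := hasDerivAt_integral_of_dominated_loc_of_deriv_le (μ := μ) (𝕜 := ℝ)
    (F := fun (t : ℝ) y => polarDensity K (z + t • u) y)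
    (F' := fun (t : ℝ) y => ⟪y, u⟫ * polarDensity K (z + t • u) y) (x₀ := 0)
    (bound := fun y => ‖u‖ * (‖y‖ ^ 1 * Real.exp (-(r / 2 * ‖y‖))))
    (Metric.ball_mem_nhds 0 hε)
    (Eventually.of_forall fun t => (continuous_polarDensity hK hne _).aestronglyMeasurable)
    (by simpa using integrable_polarDensity μ hK hne hr h)
    (by simpa using (integrable_inner_mul_polarDensity μ hK hne hr h u).aestronglyMeasurable)
    (ae_of_all _ fun y t ht => ?_)
    ((integrable_norm_pow_mul_exp_neg μ 1 (half_pos hr)).const_mul _)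
    (ae_of_all _ fun y t ht => ?_)
  · simpa using key.2
  · rw [norm_mul, Real.norm_eq_abs, Real.norm_of_nonneg (polarDensity_pos K _ y).le, pow_one, ← mul_assoc,
      mul_comm ‖u‖]
    gcongr
    · exact (polarDensity_pos K _ y).le
    · exact abs_real_inner_le_norm y u
    · exact polarDensity_le (hdom t ht) y
  · have h1 : HasDerivAt (fun t : ℝ => ⟪y, z + t • u⟫ - supportFun K y) ⟪y, u⟫ t := by
      simp only [inner_add_right, real_inner_smul_right]
      simpa using (((hasDerivAt_id t).mul_const ⟪y, u⟫).const_add ⟪y, z⟫).sub_const (supportFun K y)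
    simpa [polarDensity, mul_comm] using h1.exp

theorem integral_polarDensity (hK : IsCompact K) (hz : z ∈ K) :
    ∫ y, polarDensity K z y ∂μ =
      (Module.finrank ℝ E)! * μ.real {y | supportFun K y - ⟪y, z⟫ ≤ 1} := by
  rw [integral_eq_lintegral_of_nonneg_ae (ae_of_all _ fun y => (polarDensity_pos K z y).le)
    (continuous_polarDensity hK ⟨z, hz⟩ z).aestronglyMeasurable, lintegral_polarDensity μ hK hz,
    ENNReal.toReal_mul, ENNReal.toReal_ofReal (by positivity), Measure.real]

omit [BorelSpace E] in
theorem measure_sublevel_lt_top (hK : IsCompact K) (hz : z ∈ interior K) :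
    μ {y | supportFun K y - ⟪y, z⟫ ≤ 1} < ⊤ := by
  obtain ⟨r, hr, h⟩ := exists_inner_add_mul_norm_le_supportFun hK hz
  refine (Metric.isBounded_closedBall (x := (0 : E)) (r := r⁻¹)).subset (fun y hy => ?_)
    |>.measure_lt_top
  rw [mem_closedBall_zero_iff, ← one_div, le_div_iff₀ hr]
  have hy' : supportFun K y - ⟪y, z⟫ ≤ 1 := hy
  linarith [h y]

/-- The first order condition at a minimizing center: the polar body has its centroid at the origin,
expressed through the Laplace transform. -/
theorem integral_inner_mul_polarDensity_eq_zero (hK : IsCompact K) (hz : z ∈ interior K)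
    (hmin : ∀ w ∈ interior K, μ {y | supportFun K y - ⟪y, z⟫ ≤ 1} ≤
      μ {y | supportFun K y - ⟪y, w⟫ ≤ 1}) (u : E) :
    ∫ y, ⟪y, u⟫ * polarDensity K z y ∂μ = 0 := by
  refine IsLocalMin.hasDerivAt_eq_zero ?_ (hasDerivAt_integral_polarDensity μ hK hz u)
  have hcont : ContinuousAt (fun t : ℝ => z + t • u) 0 := by fun_prop
  have hev : ∀ᶠ t : ℝ in 𝓝 0, z + t • u ∈ interior K :=
    hcont.eventually_mem (by simpa using isOpen_interior.mem_nhds hz)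
  filter_upwards [hev] with t ht
  rw [zero_smul, add_zero, integral_polarDensity μ hK (interior_subset hz),
    integral_polarDensity μ hK (interior_subset ht)]
  refine mul_le_mul_of_nonneg_left ?_ (Nat.cast_nonneg _)
  exact ENNReal.toReal_mono (measure_sublevel_lt_top μ hK ht).ne (hmin _ ht)

/-! ### Existence of a minimizing center -/

omit [FiniteDimensional ℝ E] [μ.IsAddHaarMeasure] in
theorem lowerSemicontinuous_lintegral_polarDensity (hK : IsCompact K) (hne : K.Nonempty) :
    LowerSemicontinuous fun z => ∫⁻ y, ENNReal.ofReal (polarDensity K z y) ∂μ := by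
  intro z
  change LowerSemicontinuousAt _ z
  rw [lowerSemicontinuousAt_iff_le_liminf]
  refine le_trans (le_of_eq ?_) (lintegral_liminf_le fun z =>
    (continuous_polarDensity hK hne z).measurable.ennreal_ofReal)
  refine lintegral_congr fun y => (Tendsto.liminf_eq ?_).symm
  have : Continuous fun z => ENNReal.ofReal (polarDensity K z y) := by
    unfold polarDensity
    exact ENNReal.continuous_ofReal.comp (by fun_prop)
  exact this.tendsto z

/-- At a boundary point the sublevel set is invariant under translations in an outer normal direction,
so it contains infinitely many disjoint balls of the same radius. -/
theorem measure_sublevel_eq_top (hK : IsCompact K) (hconv : Convex ℝ K)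
    (hint : (interior K).Nonempty) (hz : z ∈ K) (hz' : z ∉ interior K) :
    μ {y | supportFun K y - ⟪y, z⟫ ≤ 1} = ⊤ := by
  have hne : K.Nonempty := ⟨z, hz⟩
  obtain ⟨f, hf⟩ := geometric_hahn_banach_open_point hconv.interior isOpen_interior hz'
  set v : E := (InnerProductSpace.toDual ℝ E).symm f
  have hv : ∀ x, ⟪v, x⟫ = f x := fun x => InnerProductSpace.toDual_symm_apply
  have hle : ∀ x ∈ K, ⟪v, x⟫ ≤ ⟪v, z⟫ := by
    intro x hx
    have hx' : x ∈ closure (interior K) := by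
      rw [hconv.closure_interior_eq_closure_of_nonempty_interior hint]
      exact subset_closure hx
    refine closure_minimal (fun a ha => ?_)
      (isClosed_le (by fun_prop) continuous_const : IsClosed {x | ⟪v, x⟫ ≤ ⟪v, z⟫}) hx'
    rw [mem_ofPred_eq, hv, hv]
    exact (hf a ha).le
  have hv0 : ‖v‖ ≠ 0 := by
    intro h0
    obtain ⟨a, ha⟩ := hint
    have := hf a ha
    rw [← hv, ← hv, norm_eq_zero.1 h0, inner_zero_left, inner_zero_left] at this
    exact lt_irrefl _ this
  obtain ⟨R, hR0, hR⟩ := hK.isBounded.exists_pos_norm_le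
  have hρ : 0 < 1 / (2 * R) := by positivity
  set ρ := 1 / (2 * R) with hρdef
  set w : E := (2 * ρ / ‖v‖) • v
  have hw : ‖w‖ = 2 * ρ := by
    rw [norm_smul, Real.norm_of_nonneg (by positivity), div_mul_cancel₀ _ hv0]
  have hhw : supportFun K w ≤ ⟪w, z⟫ := by
    rw [supportFun_smul (by positivity), real_inner_smul_left]
    exact mul_le_mul_of_nonneg_left (supportFun_le hne hle) (by positivity)
  have hsub : ∀ k : ℕ, Metric.ball ((k : ℝ) • w) ρ ⊆ {y | supportFun K y - ⟪y, z⟫ ≤ 1} := by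
    intro k y hy
    rw [mem_ball_iff_norm] at hy
    set d := y - (k : ℝ) • w
    have hyd : y = (k : ℝ) • w + d := by simp [d]
    have h1 := supportFun_add_le hK hne ((k : ℝ) • w) d
    rw [supportFun_smul (Nat.cast_nonneg k)] at h1
    have h2 := mul_le_mul_of_nonneg_left hhw (Nat.cast_nonneg (α := ℝ) k)
    have h3 := supportFun_le_mul_norm hne hR d
    have h4 : -⟪d, z⟫ ≤ ‖d‖ * R := by
      refine (neg_le_abs _).trans ((abs_real_inner_le_norm d z).trans ?_)
      gcongr
      exact hR z hz
    have h5 : 2 * R * ‖d‖ ≤ 1 := by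
      rw [hρdef, lt_div_iff₀ (by positivity)] at hy
      linarith
    rw [mem_ofPred_eq, hyd, inner_add_left, real_inner_smul_left]
    linarith
  have hdisj : Pairwise (Function.onFun Disjoint fun k : ℕ => Metric.ball ((k : ℝ) • w) ρ) := by
    intro k l hkl
    refine Metric.ball_disjoint_ball ?_
    rw [dist_eq_norm, ← sub_smul, norm_smul, hw, Real.norm_eq_abs]
    have : (1 : ℝ) ≤ |(k : ℝ) - l| := by
      have h : (1 : ℤ) ≤ |(k : ℤ) - l| := Int.one_le_abs (sub_ne_zero.2 (by exact_mod_cast hkl))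
      exact_mod_cast h
    nlinarith
  refine top_unique ?_
  calc (⊤ : ENNReal) = ∑' _ : ℕ, μ (Metric.ball 0 ρ) :=
        (ENNReal.tsum_const_eq_top_of_ne_zero (Metric.measure_ball_pos μ 0 hρ).ne').symm
    _ = μ (⋃ k : ℕ, Metric.ball ((k : ℝ) • w) ρ) := by
        rw [measure_iUnion hdisj fun k => measurableSet_ball]
        simp_rw [Measure.addHaar_ball_center μ]
    _ ≤ _ := measure_mono (iUnion_subset hsub)

theorem exists_min_measure_sublevel (hK : IsCompact K) (hconv : Convex ℝ K)
    (hint : (interior K).Nonempty) :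
    ∃ z ∈ interior K, ∀ w ∈ interior K, μ {y | supportFun K y - ⟪y, z⟫ ≤ 1} ≤
      μ {y | supportFun K y - ⟪y, w⟫ ≤ 1} := by
  have hne : K.Nonempty := hint.mono interior_subset
  obtain ⟨z, hz, hmin⟩ := LowerSemicontinuousOn.exists_isMinOn hne hK
    (lowerSemicontinuous_lintegral_polarDensity μ hK hne |>.lowerSemicontinuousOn K)
  have hmin' : ∀ w ∈ K, μ {y | supportFun K y - ⟪y, z⟫ ≤ 1} ≤
      μ {y | supportFun K y - ⟪y, w⟫ ≤ 1} := by
    intro w hw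
    have h : ∫⁻ y, ENNReal.ofReal (polarDensity K z y) ∂μ ≤
        ∫⁻ y, ENNReal.ofReal (polarDensity K w y) ∂μ := hmin hw
    rw [lintegral_polarDensity μ hK hz, lintegral_polarDensity μ hK hw] at h
    exact (ENNReal.mul_le_mul_iff_right (by simp [Nat.factorial_ne_zero]) ENNReal.ofReal_ne_top).1 h
  refine ⟨z, ?_, fun w hw => hmin' w (interior_subset hw)⟩
  by_contra hz'
  obtain ⟨a, ha⟩ := hint
  have h := (hmin' a (interior_subset ha)).trans_lt (measure_sublevel_lt_top μ hK ha)
  rw [measure_sublevel_eq_top μ hK hconv ⟨a, ha⟩ hz hz'] at h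
  exact lt_irrefl _ h

/-! ### Stability of critical centers -/

/-- `(a - b) (eᵃ - eᵇ)` is at least `(a - b)²` times the smaller exponential. -/
theorem sq_mul_exp_le_sub_mul_exp_sub {a b m : ℝ} (ha : m ≤ a) (hb : m ≤ b) :
    (a - b) ^ 2 * Real.exp m ≤ (a - b) * (Real.exp a - Real.exp b) := by
  wlog hab : b ≤ a generalizing a b
  · have := this hb ha (le_of_not_ge hab)
    linarith
  have h1 : Real.exp b * (a - b) ≤ Real.exp a - Real.exp b := by
    have h := Real.add_one_le_exp (a - b)
    have h2 : Real.exp a = Real.exp b * Real.exp (a - b) := by rw [← Real.exp_add]; congr 1; ring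
    nlinarith [Real.exp_pos b]
  have h3 : Real.exp m * (a - b) ≤ Real.exp b * (a - b) :=
    mul_le_mul_of_nonneg_right (Real.exp_le_exp.2 hb) (sub_nonneg.2 hab)
  nlinarith

theorem abs_exp_sub_exp_le {a b M : ℝ} (ha : a ≤ M) (hb : b ≤ M) :
    |Real.exp a - Real.exp b| ≤ |a - b| * Real.exp M := by
  wlog hab : b ≤ a generalizing a b
  · rw [abs_sub_comm, abs_sub_comm a]
    exact this hb ha (le_of_not_ge hab)
  rw [abs_of_nonneg (sub_nonneg.2 (Real.exp_le_exp.2 hab)), abs_of_nonneg (sub_nonneg.2 hab)]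
  have h := Real.add_one_le_exp (b - a)
  have h2 : Real.exp b = Real.exp a * Real.exp (b - a) := by rw [← Real.exp_add]; congr 1; ring
  have h3 := mul_le_mul_of_nonneg_left (Real.exp_le_exp.2 ha) (sub_nonneg.2 hab)
  nlinarith [Real.exp_pos a]

/-- The gradient of the Laplace transform is strongly monotone, with a constant depending only on a
radius `R` such that `K` and the centers lie in the ball of radius `R`. -/
theorem mul_sq_norm_le_integral_sub_integral (hne : K.Nonempty) {R : ℝ}
    (hR : ∀ x ∈ K, ‖x‖ ≤ R) {a b : E} (ha : ‖a‖ ≤ R) (hb : ‖b‖ ≤ R)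
    (hia : Integrable (fun y => ⟪y, b - a⟫ * polarDensity K a y) μ)
    (hib : Integrable (fun y => ⟪y, b - a⟫ * polarDensity K b y) μ) :
    μ.real (Metric.ball (0 : E) (1 / 4)) * (Real.exp (-(2 * R)) / 16) * ‖b - a‖ ^ 2 ≤
      (∫ y, ⟪y, b - a⟫ * polarDensity K b y ∂μ) - ∫ y, ⟪y, b - a⟫ * polarDensity K a y ∂μ := by
  have hR0 : 0 ≤ R := (norm_nonneg _).trans ha
  set u := b - a
  rcases eq_or_ne u 0 with hu | hu
  · simp [hu]
  have hu' : 0 < ‖u‖ := norm_pos_iff.2 hu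
  rw [← integral_sub hib hia]
  have hpt : ∀ y m : _, m ≤ ⟪y, b⟫ - supportFun K y → m ≤ ⟪y, a⟫ - supportFun K y →
      ⟪y, u⟫ ^ 2 * Real.exp m ≤ ⟪y, u⟫ * polarDensity K b y - ⟪y, u⟫ * polarDensity K a y := by
    intro y m h1 h2
    have h := sq_mul_exp_le_sub_mul_exp_sub h1 h2
    have h3 : ⟪y, b⟫ - supportFun K y - (⟪y, a⟫ - supportFun K y) = ⟪y, u⟫ := by
      rw [inner_sub_right]; ring
    rw [h3] at h
    rw [← mul_sub]
    exact h
  have hnn : ∀ y, 0 ≤ ⟪y, u⟫ * polarDensity K b y - ⟪y, u⟫ * polarDensity K a y := fun y =>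
    (by positivity : (0 : ℝ) ≤ _).trans (hpt y _ (min_le_left _ _) (min_le_right _ _))
  -- on the ball of radius `1 / 4` about `u / (2 ‖u‖)` one has `‖y‖ ≤ 1` and `⟪y, u⟫ ≥ ‖u‖ / 4`
  set p : E := (1 / (2 * ‖u‖)) • u
  have hp : ‖p‖ = 1 / 2 := by
    rw [norm_smul, Real.norm_of_nonneg (by positivity)]
    field_simp
  have hpu : ⟪p, u⟫ = ‖u‖ / 2 := by
    rw [real_inner_smul_left, real_inner_self_eq_norm_sq]
    field_simp
  have hball : ∀ y ∈ Metric.ball p (1 / 4), ‖u‖ ^ 2 / 16 * Real.exp (-(2 * R)) ≤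
      ⟪y, u⟫ * polarDensity K b y - ⟪y, u⟫ * polarDensity K a y := by
    intro y hy
    rw [mem_ball_iff_norm] at hy
    have hy1 : ‖y‖ ≤ 1 := by
      have := norm_sub_norm_le y p
      linarith
    have hyu : ‖u‖ / 4 ≤ ⟪y, u⟫ := by
      have h1 : ⟪y, u⟫ = ⟪p, u⟫ + ⟪y - p, u⟫ := by rw [inner_sub_left]; ring
      have h2 := (abs_le.1 (abs_real_inner_le_norm (y - p) u)).1
      nlinarith
    have hexp : ∀ c : E, ‖c‖ ≤ R → -(2 * R) ≤ ⟪y, c⟫ - supportFun K y := by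
      intro c hc
      have h1 := (abs_le.1 (abs_real_inner_le_norm y c)).1
      have h2 := supportFun_le_mul_norm hne hR y
      nlinarith [norm_nonneg y, norm_nonneg c]
    refine le_trans ?_ (hpt y _ (hexp b hb) (hexp a ha))
    gcongr
    nlinarith
  calc μ.real (Metric.ball (0 : E) (1 / 4)) * (Real.exp (-(2 * R)) / 16) * ‖u‖ ^ 2
      = ∫ _ in Metric.ball p (1 / 4), ‖u‖ ^ 2 / 16 * Real.exp (-(2 * R)) ∂μ := by
        rw [setIntegral_const, smul_eq_mul, Measure.real, Measure.real,
          Measure.addHaar_ball_center μ p]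
        ring
    _ ≤ ∫ y in Metric.ball p (1 / 4),
          (⟪y, u⟫ * polarDensity K b y - ⟪y, u⟫ * polarDensity K a y) ∂μ :=
        setIntegral_mono_on (integrableOn_const (measure_ball_lt_top).ne)
          (hib.sub hia).integrableOn measurableSet_ball hball
    _ ≤ _ := setIntegral_le_integral (hib.sub hia) (ae_of_all _ hnn)

theorem abs_integral_sub_integral_le (hK : IsCompact K) (hKne : K.Nonempty) (hL : IsCompact L)
    (hLne : L.Nonempty) {r d : ℝ} (hr : 0 < r)
    (hzK : ∀ y, ⟪y, z⟫ + r * ‖y‖ ≤ supportFun K y) (hzL : ∀ y, ⟪y, z⟫ + r * ‖y‖ ≤ supportFun L y)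
    (hd : ∀ y, |supportFun K y - supportFun L y| ≤ d * ‖y‖) (u : E) :
    |(∫ y, ⟪y, u⟫ * polarDensity K z y ∂μ) - ∫ y, ⟪y, u⟫ * polarDensity L z y ∂μ| ≤
      ‖u‖ * d * ∫ y, ‖y‖ ^ 2 * Real.exp (-(r * ‖y‖)) ∂μ := by
  rw [← integral_sub (integrable_inner_mul_polarDensity μ hK hKne hr hzK u)
    (integrable_inner_mul_polarDensity μ hL hLne hr hzL u), ← integral_const_mul, ← Real.norm_eq_abs]
  refine norm_integral_le_of_norm_le ((integrable_norm_pow_mul_exp_neg μ 2 hr).const_mul _)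
    (ae_of_all _ fun y => ?_)
  have h1 : |polarDensity K z y - polarDensity L z y| ≤ d * ‖y‖ * Real.exp (-(r * ‖y‖)) := by
    refine (abs_exp_sub_exp_le (M := -(r * ‖y‖)) (by linarith [hzK y])
      (by linarith [hzL y])).trans ?_
    gcongr
    rw [sub_sub_sub_cancel_left, abs_sub_comm]
    exact hd y
  rw [← mul_sub, norm_mul, Real.norm_eq_abs, Real.norm_eq_abs]
  calc _ ≤ (‖y‖ * ‖u‖) * (d * ‖y‖ * Real.exp (-(r * ‖y‖))) :=
        mul_le_mul (abs_real_inner_le_norm y u) h1 (abs_nonneg _) (by positivity)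
    _ = _ := by ring

/-- Critical points of the Laplace transforms of two bodies differ by at most a constant times the
distance of the bodies. Only the first center `a` has to lie uniformly deep inside both bodies. -/
theorem mul_norm_sub_le_of_critical (hK : IsCompact K) (hL : IsCompact L) {R r d : ℝ}
    (hd0 : 0 ≤ d) (hLR : ∀ x ∈ L, ‖x‖ ≤ R) {a b : E} (ha : ‖a‖ ≤ R) (hKne : K.Nonempty) (hr : 0 < r)
    (haK : ∀ y, ⟪y, a⟫ + r * ‖y‖ ≤ supportFun K y) (haL : ∀ y, ⟪y, a⟫ + r * ‖y‖ ≤ supportFun L y)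
    (hb : b ∈ interior L) (hd : ∀ y, |supportFun K y - supportFun L y| ≤ d * ‖y‖)
    (hca : ∀ u, ∫ y, ⟪y, u⟫ * polarDensity K a y ∂μ = 0)
    (hcb : ∀ u, ∫ y, ⟪y, u⟫ * polarDensity L b y ∂μ = 0) :
    μ.real (Metric.ball (0 : E) (1 / 4)) * (Real.exp (-(2 * R)) / 16) * ‖b - a‖ ≤
      d * ∫ y, ‖y‖ ^ 2 * Real.exp (-(r * ‖y‖)) ∂μ := by
  have hLne : L.Nonempty := ⟨b, interior_subset hb⟩
  obtain ⟨r', hr', hbL⟩ := exists_inner_add_mul_norm_le_supportFun hL hb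
  have h1 := mul_sq_norm_le_integral_sub_integral μ hLne hLR ha (hLR b (interior_subset hb))
    (integrable_inner_mul_polarDensity μ hL hLne hr haL (b - a))
    (integrable_inner_mul_polarDensity μ hL hLne hr' hbL (b - a))
  have h2 := abs_integral_sub_integral_le μ hK hKne hL hLne hr haK haL hd (b - a)
  rw [hcb] at h1
  rw [hca] at h2
  rcases eq_or_ne (b - a) 0 with hu | hu
  · have hI : 0 ≤ ∫ y : E, ‖y‖ ^ 2 * Real.exp (-(r * ‖y‖)) ∂μ :=
      integral_nonneg fun y => by positivity
    rw [hu, norm_zero, mul_zero]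
    positivity
  · have hu' : 0 < ‖b - a‖ := norm_pos_iff.2 hu
    refine le_of_mul_le_mul_right ?_ hu'
    have h3 := (le_abs_self _).trans h2
    linarith

/-- The local Lipschitz estimate for critical centers, around a fixed body `K`. -/
theorem exists_lipschitz_critical_center (hK : IsCompact K) {a : E} (ha : a ∈ interior K)
    (hca : ∀ u, ∫ y, ⟪y, u⟫ * polarDensity K a y ∂μ = 0) :
    ∃ C : ℝ, 0 < C ∧ ∃ δ : ℝ, 0 < δ ∧ ∀ L : Set E, IsCompact L → ∀ b ∈ interior L,
      (∀ u, ∫ y, ⟪y, u⟫ * polarDensity L b y ∂μ = 0) → Metric.hausdorffDist L K ≤ δ →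
        ‖b - a‖ ≤ C * Metric.hausdorffDist L K := by
  have hKne : K.Nonempty := ⟨a, interior_subset ha⟩
  obtain ⟨r, hr, h⟩ := exists_inner_add_mul_norm_le_supportFun hK ha
  obtain ⟨R, hR0, hR⟩ := hK.isBounded.exists_pos_norm_le
  set c := μ.real (Metric.ball (0 : E) (1 / 4)) * (Real.exp (-(2 * (R + r / 2))) / 16)
  set I := ∫ y : E, ‖y‖ ^ 2 * Real.exp (-(r / 2 * ‖y‖)) ∂μ
  have hc : 0 < c := by
    have : 0 < μ.real (Metric.ball (0 : E) (1 / 4)) :=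
      ENNReal.toReal_pos (Metric.measure_ball_pos μ 0 (by norm_num)).ne' measure_ball_lt_top.ne
    positivity
  have hI : 0 ≤ I := integral_nonneg fun y => by positivity
  -- `+ 1` because `I` vanishes in dimension zero
  refine ⟨(I + 1) / c, by positivity, r / 2, by positivity, fun L hL b hb hcb hδ => ?_⟩
  have hLne : L.Nonempty := ⟨b, interior_subset hb⟩
  have hd0 : 0 ≤ Metric.hausdorffDist L K := Metric.hausdorffDist_nonneg
  have hKL := supportFun_le_add_hausdorffDist hK hKne hL hLne
  have hLK := supportFun_le_add_hausdorffDist hL hLne hK hKne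
  rw [Metric.hausdorffDist_comm] at hKL
  set d := Metric.hausdorffDist L K
  have hLR : ∀ x ∈ L, ‖x‖ ≤ R + r / 2 := by
    intro x hx
    obtain ⟨w, hw, hxw⟩ := exists_norm_sub_le_hausdorffDist hL hK hKne hx
    have h1 := norm_sub_norm_le x w
    linarith [hR w hw]
  have key := mul_norm_sub_le_of_critical μ hK hL hd0 hLR
    ((hR a (interior_subset ha)).trans (by linarith)) hKne (half_pos hr)
    (fun y => by nlinarith [h y, norm_nonneg y])
    (fun y => by nlinarith [h y, hKL y, norm_nonneg y])
    hb (fun y => abs_le.2 ⟨by linarith [hLK y], by linarith [hKL y]⟩) hca hcb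
  change c * ‖b - a‖ ≤ d * I at key
  rw [div_mul_eq_mul_div, le_div_iff₀ hc]
  linarith

theorem critical_center_unique (hK : IsCompact K) {a b : E} (ha : a ∈ interior K)
    (hb : b ∈ interior K) (hca : ∀ u, ∫ y, ⟪y, u⟫ * polarDensity K a y ∂μ = 0)
    (hcb : ∀ u, ∫ y, ⟪y, u⟫ * polarDensity K b y ∂μ = 0) : b = a := by
  obtain ⟨C, -, δ, hδ, h⟩ := exists_lipschitz_critical_center μ hK ha hca
  have h' := h K hK b hb hcb (by rw [Metric.hausdorffDist_self_zero]; exact hδ.le)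
  rw [Metric.hausdorffDist_self_zero, mul_zero] at h'
  exact sub_eq_zero.1 (norm_le_zero_iff.1 h')

end PolarDensity

/-! ### Santaló points -/

section Santalo

variable {n : ℕ}

theorem polarBody_eq_sublevel {K : Set (EuclideanSpace ℝ (Fin n))} (hK : IsCompact K)
    (hne : K.Nonempty) (z : EuclideanSpace ℝ (Fin n)) :
    polarBody K z = {y | supportFun K y - ⟪y, z⟫ ≤ 1} := by
  ext y
  simp only [polarBody, mem_ofPred_eq, inner_sub_right]
  constructor
  · intro h
    have := supportFun_le hne (a := 1 + ⟪y, z⟫) fun x hx => by linarith [h x hx]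
    linarith
  · intro h x hx
    linarith [inner_le_supportFun hK y hx]

theorem IsSantaloPoint.integral_inner_mul_polarDensity_eq_zero
    {K : Set (EuclideanSpace ℝ (Fin n))} (hK : IsCompact K) {z : EuclideanSpace ℝ (Fin n)}
    (hz : IsSantaloPoint K z) (u : EuclideanSpace ℝ (Fin n)) :
    ∫ y, ⟪y, u⟫ * polarDensity K z y = 0 := by
  have hne : K.Nonempty := ⟨z, interior_subset hz.1⟩
  refine _root_.integral_inner_mul_polarDensity_eq_zero volume hK hz.1 (fun w hw => ?_) u
  rw [← polarBody_eq_sublevel hK hne, ← polarBody_eq_sublevel hK hne]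
  exact hz.2 w hw

theorem existsUnique_isSantaloPoint (K : FullConvexBody n) :
    ∃! z : EuclideanSpace ℝ (Fin n),
      IsSantaloPoint (K.1 : Set (EuclideanSpace ℝ (Fin n))) z := by
  have hK := K.1.isCompact
  obtain ⟨z, hz, hmin⟩ := exists_min_measure_sublevel volume hK K.1.convex K.2
  have hsan : IsSantaloPoint (K.1 : Set (EuclideanSpace ℝ (Fin n))) z := by
    refine ⟨hz, fun w hw => ?_⟩
    rw [polarBody_eq_sublevel hK K.1.nonempty, polarBody_eq_sublevel hK K.1.nonempty]
    exact hmin w hw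
  exact ⟨z, hsan, fun w hw => critical_center_unique volume hK hz hw.1
    (hsan.integral_inner_mul_polarDensity_eq_zero hK) (hw.integral_inner_mul_polarDensity_eq_zero hK)⟩

theorem isSantaloPoint_santaloMap (K : FullConvexBody n) :
    IsSantaloPoint (K.1 : Set (EuclideanSpace ℝ (Fin n))) (santaloMap K) :=
  Classical.epsilon_spec (existsUnique_isSantaloPoint K).exists

theorem santaloMap_locally_lipschitz_at (K₀ : FullConvexBody n) :
    ∃ C : ℝ, 0 < C ∧ ∃ δ : ℝ, 0 < δ ∧ ∀ K : FullConvexBody n, dist K K₀ ≤ δ →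
      ‖santaloMap K - santaloMap K₀‖ ≤ C * dist K K₀ := by
  have h₀ := isSantaloPoint_santaloMap K₀
  obtain ⟨C, hC, δ, hδ, h⟩ := exists_lipschitz_critical_center volume K₀.1.isCompact h₀.1
    (h₀.integral_inner_mul_polarDensity_eq_zero K₀.1.isCompact)
  refine ⟨C, hC, δ, hδ, fun K hK => ?_⟩
  have hs := isSantaloPoint_santaloMap K
  rw [Subtype.dist_eq, ← ConvexBody.hausdorffDist_coe] at hK ⊢
  exact h _ K.1.isCompact _ hs.1 (hs.integral_inner_mul_polarDensity_eq_zero K.1.isCompact) hK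

end Santalo

theorem proposition2p1 (n : ℕ) :
    (∀ K : FullConvexBody n,
      ∃! z : EuclideanSpace ℝ (Fin n), IsSantaloPoint (K.1 : Set (EuclideanSpace ℝ (Fin n))) z) ∧
    Continuous (santaloMap : FullConvexBody n → EuclideanSpace ℝ (Fin n)) ∧
    ∀ K₀ : FullConvexBody n, ∃ C : ℝ, 0 < C ∧ ∃ δ : ℝ, 0 < δ ∧
      ∀ K : FullConvexBody n, dist K K₀ ≤ δ →
        ‖santaloMap K - santaloMap K₀‖ ≤ C * dist K K₀ := by
  refine ⟨existsUnique_isSantaloPoint, ?_, santaloMap_locally_lipschitz_at⟩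
  refine continuous_iff_continuousAt.2 fun K₀ => ?_
  obtain ⟨C, -, δ, hδ, h⟩ := santaloMap_locally_lipschitz_at K₀
  exact continuousAt_of_locally_lipschitz hδ C fun K hK => by
    rw [dist_eq_norm]
    exact h K hK.le
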